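/- Let $(c_n)_{n\ge 0}$ be the sequence of rational numbers defined by \[ c_0 = 1,\qquad c_1 = \frac{-161}{2^{10}\cdot 3^{5}},\qquad c_2 = \frac{26605753}{2^{23}\cdot 3^{12}\cdot 5^{2}}, \] and, for all $n\ge 3$, \begin{align*} &80352000\, n(5n-1)(5n-2)(5n-4)\, c_{n}\\ &\quad + 25\left(2592000 n^{4}-16588800 n^{3}+39118320 n^{2}-39189168 n+14092603\right) c_{n-1}\\ &\quad + 20\left(4500 n^{2}-18900 n+19739\right) c_{n-2} + c_{n-3} = 0 . \end{align*} Define the Yang--Zagier numbers by \[ a_n = c_n\cdot (3/5)_n\cdot (4/5)_n\cdot \left(2^{10}\cdot 3^5\cdot 5^4\right)^n \qquad (n\ge 0), \] where $(x)_n = x(x+1)\cdots(x+n-1)$ denotes the rising factorial. Then the generating function $f(x)=\sum_{n\ge 0} a_n x^n\in\mathbb{Q}[[x]]$ is algebraic, that is, there exists a nonzero polynomial $P(x,y)\in\mathbb{Q}[x,y]$ such that $P(x,f(x))=0$. -/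

import Mathlib

/-- The sequence `c 0, c 1, c 2, …` of rationals with
`c 0 = 1`, `c 1 = -161/(2^10 * 3^5)`, `c 2 = 26605753/(2^23 * 3^12 * 5^2)` and, for `n ≥ 3`,
`80352000 n (5n-1)(5n-2)(5n-4) c n
  + 25 (2592000 n^4 - 16588800 n^3 + 39118320 n^2 - 39189168 n + 14092603) c (n-1)
  + 20 (4500 n^2 - 18900 n + 19739) c (n-2) + c (n-3) = 0`.
The recurrence is solved for its leading term, whose coefficient never vanishes for `n ≥ 3`;
below, `k + 3` plays the role of `n`. That the recurrence holds as displayed is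
`yangZagierC_recurrence`. -/
def yangZagierC : ℕ → ℚ
  | 0 => 1
  | 1 => -161 / (2 ^ 10 * 3 ^ 5)
  | 2 => 26605753 / (2 ^ 23 * 3 ^ 12 * 5 ^ 2)
  | k + 3 =>
    (-(25 * (2592000 * ((k : ℚ) + 3) ^ 4 - 16588800 * ((k : ℚ) + 3) ^ 3
            + 39118320 * ((k : ℚ) + 3) ^ 2 - 39189168 * ((k : ℚ) + 3) + 14092603)
          * yangZagierC (k + 2)
        + 20 * (4500 * ((k : ℚ) + 3) ^ 2 - 18900 * ((k : ℚ) + 3) + 19739) * yangZagierC (k + 1)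
        + yangZagierC k))
      / (80352000 * ((k : ℚ) + 3) * (5 * ((k : ℚ) + 3) - 1) * (5 * ((k : ℚ) + 3) - 2)
          * (5 * ((k : ℚ) + 3) - 4))

/-- The defining third-order recurrence of `yangZagierC`. -/
theorem yangZagierC_recurrence (n : ℕ) (hn : 3 ≤ n) :
    80352000 * (n : ℚ) * (5 * (n : ℚ) - 1) * (5 * (n : ℚ) - 2) * (5 * (n : ℚ) - 4)
        * yangZagierC n
      + 25 * (2592000 * (n : ℚ) ^ 4 - 16588800 * (n : ℚ) ^ 3 + 39118320 * (n : ℚ) ^ 2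
          - 39189168 * (n : ℚ) + 14092603) * yangZagierC (n - 1)
      + 20 * (4500 * (n : ℚ) ^ 2 - 18900 * (n : ℚ) + 19739) * yangZagierC (n - 2)
      + yangZagierC (n - 3) = 0 := by
  obtain ⟨k, rfl⟩ := Nat.exists_eq_add_of_le' hn
  have h1 : k + 3 - 1 = k + 2 := rfl
  have h2 : k + 3 - 2 = k + 1 := rfl
  have h3 : k + 3 - 3 = k := rfl
  have hk : (0 : ℚ) ≤ (k : ℚ) := Nat.cast_nonneg k
  have hd : 80352000 * ((k : ℚ) + 3) * (5 * ((k : ℚ) + 3) - 1) * (5 * ((k : ℚ) + 3) - 2)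
      * (5 * ((k : ℚ) + 3) - 4) ≠ 0 := by
    have e1 : (0 : ℚ) < (k : ℚ) + 3 := by linarith
    have e2 : (0 : ℚ) < 5 * ((k : ℚ) + 3) - 1 := by linarith
    have e3 : (0 : ℚ) < 5 * ((k : ℚ) + 3) - 2 := by linarith
    have e4 : (0 : ℚ) < 5 * ((k : ℚ) + 3) - 4 := by linarith
    positivity
  rw [h1, h2, h3, yangZagierC]
  push_cast
  rw [mul_div_cancel₀ _ hd]
  ring

/-- The Yang–Zagier numbers `a n = c n * (3/5)_n * (4/5)_n * (2^10 * 3^5 * 5^4)^n`, where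
`(x)_n = x (x+1) ⋯ (x+n-1)` is the rising factorial. -/
noncomputable def yangZagierA (n : ℕ) : ℚ :=
  yangZagierC n * (ascPochhammer ℚ n).eval (3 / 5) * (ascPochhammer ℚ n).eval (4 / 5)
    * (2 ^ 10 * 3 ^ 5 * 5 ^ 4) ^ n

/-!
# Algebraicity of the generating function of the Yang–Zagier numbers

In the variable `w = 43200 x` the generating function `g` satisfies a second order linear
differential equation with icosahedral projective monodromy.  It is a Klein pullback: there is
a power series `s` in `w` with
`1728 s e(s)⁵ / H(s)³ = -20131375 w⁴ q(w)³ V(w)⁵ / P(w)³`, where `s e(s)`, `H(s)`, `T(s)` are the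
dehomogenized vertex, face and edge forms of the icosahedron, and `g ^ 20` is a constant multiple
of `P(w) / (q(w)¹² H(s))`.  We construct `s` and `g` by Hensel's lemma, so that they are algebraic,
and check that the coefficients of `g` obey the recurrence of the Yang–Zagier numbers.
-/

/-! Put `φ = -20131375 w⁴ q³ V⁵ / P³` and `J = 1728 s e⁵ / H³`. Then `1 - φ = Q² / P³` with `Q` the
form `edgePoly` (`facePoly_cube`), just as `1 - J = T² / H³` (`kleinEdge_sq`). A solution `s` of
`J(s) = φ(w)` and the root `g` built from it are algebraic by construction; the work lies in
identifying `g`.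

The logarithmic derivative of `J(s) = φ(w)` expresses the Euler derivative of `s` through `w`, `s`
and `g`. With the companion `G`, a constant multiple of `q¹⁸ g³¹ s e H'(s)`, it gives a linear first
order system whose coefficients are rational in `w` (`system_left`, `system_right`); eliminating `G`
leaves a second order equation `L g = 0` (`ode_of_system`).

The Yang–Zagier recurrence encodes a fourth order operator `M` with `(31 - 7w)² M = A L` for some
second order `A` (`recurrenceExpr_relation`). The factor `(31 - 7w)²` is invertible on power series,
so `M g = 0`, and this recurrence with constant term `1` determines all coefficients
(`eq_yangZagierA`). -/

namespace YangZagier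

/-! ### Icosahedral forms and the pullback map -/

section Polynomials

variable {R : Type*} [CommRing R]

/-- The vertex form of the icosahedron, dehomogenized and divided by its variable. -/
def kleinVertex (s : R) : R :=
  s ^ 2 - 11 * s - 1

/-- The dehomogenized face form (Hessian of the vertex form) of the icosahedron. -/
def kleinFace (s : R) : R :=
  s ^ 4 + 228 * s ^ 3 + 494 * s ^ 2 - 228 * s + 1

/-- The dehomogenized edge form of the icosahedron. -/
def kleinEdge (s : R) : R :=
  s ^ 6 - 522 * s ^ 5 - 10005 * s ^ 4 - 10005 * s ^ 2 + 522 * s + 1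

/-- The derivative of `kleinFace`. -/
def kleinFaceDeriv (s : R) : R :=
  4 * s ^ 3 + 684 * s ^ 2 + 988 * s - 228

/-- The quadratic polynomial whose roots are singular points of the differential equation. -/
def singQuad (w : R) : R :=
  w ^ 2 + 25 * w + 5

/-- The roots of this polynomial lie over the vertices of the icosahedron. -/
def vertexPoly (w : R) : R :=
  1977326743 * w ^ 5 + 2317567651 * w ^ 4 + 1402771335 * w ^ 3 + 445622020 * w ^ 2
    + 67982800 * w + 4017600

/-- The roots of this polynomial lie over the face centres of the icosahedron. -/
def facePoly (w : R) : R :=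
  79792266297612001 * w ^ 12 - 11112498537285831525 * w ^ 11
    - 41853808814694460430 * w ^ 10 - 45564688433918663625 * w ^ 9
    - 20725967386574120550 * w ^ 8 - 2319673650478958125 * w ^ 7
    + 1857203229845506125 * w ^ 6 + 1029378711852150000 * w ^ 5
    + 266420387178220000 * w ^ 4 + 42262446160000000 * w ^ 3 + 4258031738400000 * w ^ 2
    + 252875520000000 * w + 6718464000000

/-- The roots of this polynomial lie over the edge midpoints of the icosahedron. -/
def edgePoly (w : R) : R :=
  22539340290692258087863249 * w ^ 18 + 8790268954595899136197122725 * w ^ 17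
    + 15437852310051792289982786270 * w ^ 16 + 137264876403449291033066094250 * w ^ 15
    + 402714393281688183837059488675 * w ^ 14 + 555565018386464286526185601875 * w ^ 13
    + 458539493064888351647458358250 * w ^ 12 + 254834956285068320140447068750 * w ^ 11
    + 102424555368671205835676383125 * w ^ 10 + 31408227023675590598179140625 * w ^ 9
    + 7705857069649447282979900000 * w ^ 8 + 1575916181507511770078750000 * w ^ 7
    + 274343904373342583122000000 * w ^ 6 + 40123286570246962300000000 * w ^ 5
    + 4714364036121814080000000 * w ^ 4 + 417840850892808000000000 * w ^ 3
    + 25806678298099200000000 * w ^ 2 + 983180021760000000000 * w + 17414258688000000000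

/-- The Euler derivative `w * d/dw` of `singQuad`. -/
def singQuadEuler (w : R) : R :=
  2 * w ^ 2 + 25 * w

/-- The Euler derivative `w * d/dw` of `vertexPoly`. -/
def vertexPolyEuler (w : R) : R :=
  9886633715 * w ^ 5 + 9270270604 * w ^ 4 + 4208314005 * w ^ 3 + 891244040 * w ^ 2
    + 67982800 * w

/-- The Euler derivative `w * d/dw` of `facePoly`. -/
def facePolyEuler (w : R) : R :=
  957507195571344012 * w ^ 12 - 122237483910144146775 * w ^ 11
    - 418538088146944604300 * w ^ 10 - 410082195905267972625 * w ^ 9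
    - 165807739092592964400 * w ^ 8 - 16237715553352706875 * w ^ 7
    + 11143219379073036750 * w ^ 6 + 5146893559260750000 * w ^ 5
    + 1065681548712880000 * w ^ 4 + 126787338480000000 * w ^ 3 + 8516063476800000 * w ^ 2
    + 252875520000000 * w

/-- The numerator of the logarithmic Euler derivative of `facePoly / singQuad ^ 12`. -/
def logDerivNum (w : R) : R := facePolyEuler w * singQuad w - 12 * singQuadEuler w * facePoly w

theorem facePoly_cube (w : R) :
    facePoly w ^ 3 + 20131375 * w ^ 4 * singQuad w ^ 3 * vertexPoly w ^ 5 = edgePoly w ^ 2 := by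
  unfold facePoly singQuad vertexPoly edgePoly
  ring

theorem kleinEdge_sq (s : R) :
    kleinEdge s ^ 2 = kleinFace s ^ 3 - 1728 * s * kleinVertex s ^ 5 := by
  unfold kleinFace kleinVertex kleinEdge
  ring

/-- This is the logarithmic Euler derivative of `φ`, cleared of denominators. Besides `Q` only `7 *
w - 31` survives: `w = 31/7` is a further ramification point, and `odeCoeff₂` equals `3600 * (7 * w
- 31) * singQuad w`. -/
theorem pullback_ramification (w : R) :
    4 * singQuad w * vertexPoly w * facePoly w + 3 * singQuadEuler w * vertexPoly w * facePoly w
      + 5 * singQuad w * vertexPolyEuler w * facePoly w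
      - 3 * singQuad w * vertexPoly w * facePolyEuler w = -((7 * w - 31) * edgePoly w) := by
  unfold facePoly singQuad vertexPoly edgePoly singQuadEuler vertexPolyEuler facePolyEuler
  ring

/-- The same computation for `J`; here no factor besides `T` appears. -/
theorem klein_ramification (s : R) :
    kleinVertex s * kleinFace s + 5 * s * (2 * s - 11) * kleinFace s
      - 3 * s * kleinVertex s * kleinFaceDeriv s = -kleinEdge s := by
  unfold kleinFace kleinVertex kleinEdge kleinFaceDeriv
  ring

end Polynomials

/-! ### The differential equation and the first order system -/

section DifferentialIdentities

variable {R : Type*} [CommRing R]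

/-- The second iterated Euler derivative of `facePoly`. -/
def facePolyEuler₂ (w : R) : R :=
  11490086346856128144 * w ^ 12 - 1344612323011585614525 * w ^ 11
    - 4185380881469446043000 * w ^ 10 - 3690739763147411753625 * w ^ 9
    - 1326461912740743715200 * w ^ 8 - 113664008873468948125 * w ^ 7
    + 66859316274438220500 * w ^ 6 + 25734467796303750000 * w ^ 5
    + 4262726194851520000 * w ^ 4 + 380362015440000000 * w ^ 3 + 17032126953600000 * w ^ 2
    + 252875520000000 * w

/-- The Euler derivative of `logDerivNum`. -/
def logDerivNumEuler (w : R) : R :=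
  facePolyEuler₂ w * singQuad w - 11 * facePolyEuler w * singQuadEuler w
    - 12 * (4 * w ^ 2 + 25 * w) * facePoly w

/-- Coefficient of the zeroth Euler derivative in the differential equation. -/
def odeCoeff₀ (w : R) : R := 12096 * w ^ 3 - 139453 * w ^ 2 - 124775 * w

/-- Coefficient of the first Euler derivative in the differential equation. -/
def odeCoeff₁ (w : R) : R := 35280 * w ^ 3 - 393840 * w ^ 2 - 2458800 * w + 446400

/-- Coefficient of the second Euler derivative in the differential equation. -/
def odeCoeff₂ (w : R) : R := 25200 * w ^ 3 + 518400 * w ^ 2 - 2664000 * w - 558000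

/-- The common denominator of the first order system satisfied by the pullback. -/
def sysDenom (w : R) : R := 20 * singQuad w * facePoly w * vertexPoly w

/-- The Euler derivative of `sysDenom`. -/
def sysDenomEuler (w : R) : R :=
  20 * (singQuadEuler w * facePoly w * vertexPoly w + singQuad w * facePolyEuler w * vertexPoly w
    + singQuad w * facePoly w * vertexPolyEuler w)

/-- A diagonal coefficient of the first order system satisfied by the pullback. -/
def sysDiag (w : R) : R :=
  31 * logDerivNum w * vertexPoly w + 360 * singQuadEuler w * facePoly w * vertexPoly w
    - 4 * (7 * w - 31) * edgePoly w

/-- An off-diagonal coefficient of the first order system satisfied by the pullback. -/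
def sysOffDiag (w : R) : R :=
  -(19 * 20131375 * (7 * w - 31) * w ^ 4 * singQuad w ^ 3 * vertexPoly w ^ 5)

-- Substituting the first order system into the second order equation leaves a combination of `g`
-- and `G`. This identity kills the coefficient of `g`, and `ode_identity_right` that of `G`.
set_option maxHeartbeats 4000000 in
theorem ode_identity_left (w : R) :
    9 * odeCoeff₂ w * (sysDenom w * (vertexPolyEuler w * logDerivNum w
          + vertexPoly w * logDerivNumEuler w)
        - sysDenomEuler w * (vertexPoly w * logDerivNum w) + (vertexPoly w * logDerivNum w) ^ 2)
      + odeCoeff₂ w * (31 - 7 * w) * sysOffDiag w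
      + 9 * odeCoeff₁ w * sysDenom w * (vertexPoly w * logDerivNum w)
      + 9 * odeCoeff₀ w * sysDenom w ^ 2 = 0 := by
  unfold odeCoeff₂ odeCoeff₁ odeCoeff₀ sysOffDiag sysDenom sysDenomEuler logDerivNumEuler
    logDerivNum facePolyEuler₂ facePolyEuler facePoly vertexPoly vertexPolyEuler singQuad
    singQuadEuler
  ring

set_option maxHeartbeats 4000000 in
theorem ode_identity_right (w : R) :
    odeCoeff₂ w * (sysDenom w * (-(7 * w)) - sysDenomEuler w * (31 - 7 * w)
        + vertexPoly w * logDerivNum w * (31 - 7 * w) + (31 - 7 * w) * sysDiag w)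
      + odeCoeff₁ w * sysDenom w * (31 - 7 * w) = 0 := by
  unfold odeCoeff₂ odeCoeff₁ sysDiag sysDenom sysDenomEuler
    logDerivNum facePolyEuler facePoly vertexPoly vertexPolyEuler singQuad
    singQuadEuler edgePoly
  ring

end DifferentialIdentities

/-! ### Derivations with `D w = w`, and elimination of `G` -/

section Derivations

variable {k R : Type*} [CommRing k] [CommRing R] [Algebra k R] (D : Derivation k R R)

theorem derivation_ofNat (n : ℕ) [n.AtLeastTwo] : D (ofNat(n) : R) = 0 :=
  D.map_natCast n

theorem derivation_singQuad {w : R} (hw : D w = w) : D (singQuad w) = singQuadEuler w := by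
  simp only [singQuad, singQuadEuler, map_add, D.leibniz, D.leibniz_pow, hw, derivation_ofNat,
    smul_eq_mul, nsmul_eq_mul]
  push_cast
  ring

theorem derivation_vertexPoly {w : R} (hw : D w = w) : D (vertexPoly w) = vertexPolyEuler w := by
  simp only [vertexPoly, vertexPolyEuler, map_add, D.leibniz, D.leibniz_pow, hw, derivation_ofNat,
    smul_eq_mul, nsmul_eq_mul]
  push_cast
  ring

theorem derivation_facePoly {w : R} (hw : D w = w) : D (facePoly w) = facePolyEuler w := by
  simp only [facePoly, facePolyEuler, map_add, map_sub, D.leibniz, D.leibniz_pow, hw,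
    derivation_ofNat, smul_eq_mul, nsmul_eq_mul]
  push_cast
  ring

theorem derivation_facePolyEuler {w : R} (hw : D w = w) :
    D (facePolyEuler w) = facePolyEuler₂ w := by
  simp only [facePolyEuler, facePolyEuler₂, map_add, map_sub, D.leibniz, D.leibniz_pow, hw,
    derivation_ofNat, smul_eq_mul, nsmul_eq_mul]
  push_cast
  ring

theorem derivation_logDerivNum {w : R} (hw : D w = w) :
    D (logDerivNum w) = logDerivNumEuler w := by
  have h : D (singQuadEuler w) = 4 * w ^ 2 + 25 * w := by
    simp only [singQuadEuler, map_add, D.leibniz, D.leibniz_pow, hw,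
      derivation_ofNat, smul_eq_mul, nsmul_eq_mul]
    push_cast
    ring
  simp only [logDerivNum, logDerivNumEuler, map_sub, D.leibniz, derivation_singQuad D hw,
    derivation_facePoly D hw, derivation_facePolyEuler D hw, h, derivation_ofNat, smul_eq_mul]
  ring

theorem derivation_sysDenom {w : R} (hw : D w = w) : D (sysDenom w) = sysDenomEuler w := by
  simp only [sysDenom, sysDenomEuler, D.leibniz, derivation_singQuad D hw,
    derivation_facePoly D hw, derivation_vertexPoly D hw, derivation_ofNat, smul_eq_mul]
  ring

theorem derivation_kleinVertex (s : R) : D (kleinVertex s) = (2 * s - 11) * D s := by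
  simp only [kleinVertex, map_sub, D.leibniz, D.leibniz_pow, derivation_ofNat, D.map_one_eq_zero,
    smul_eq_mul, nsmul_eq_mul]
  push_cast
  ring

theorem derivation_kleinFace (s : R) : D (kleinFace s) = kleinFaceDeriv s * D s := by
  simp only [kleinFace, kleinFaceDeriv, map_add, map_sub, D.leibniz, D.leibniz_pow,
    derivation_ofNat, D.map_one_eq_zero, smul_eq_mul, nsmul_eq_mul]
  push_cast
  ring

/-- The first order system of the pullback implies the second order differential equation. -/
theorem ode_of_system [IsDomain R] [CharZero R] {w g G : R} (hw : D w = w)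
    (hM : sysDenom w ≠ 0)
    (h₁ : sysDenom w * D g = vertexPoly w * logDerivNum w * g + (31 - 7 * w) * G)
    (h₂ : 9 * (sysDenom w * D G) = 9 * (sysDiag w * G) + sysOffDiag w * g) :
    odeCoeff₂ w * D (D g) + odeCoeff₁ w * D g + odeCoeff₀ w * g = 0 := by
  have h₃ := congrArg D h₁
  simp only [map_add, map_sub, D.leibniz, derivation_sysDenom D hw, derivation_vertexPoly D hw,
    derivation_logDerivNum D hw, derivation_ofNat, hw, smul_eq_mul] at h₃
  have h9 : (9 : R) * sysDenom w ^ 2 ≠ 0 := mul_ne_zero (by norm_num) (pow_ne_zero _ hM)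
  refine (mul_eq_zero.mp ?_).resolve_left h9
  linear_combination 9 * odeCoeff₂ w * sysDenom w * h₃ + odeCoeff₂ w * (31 - 7 * w) * h₂
    + (9 * odeCoeff₂ w * (vertexPoly w * logDerivNum w) - 9 * odeCoeff₂ w * sysDenomEuler w
      + 9 * odeCoeff₁ w * sysDenom w) * h₁
    + ode_identity_left w * g + 9 * ode_identity_right w * G

end Derivations

/-! ### The first order system satisfied by `g` and `G` -/

section Pullback

variable {R : Type*} [CommRing R]

/-- The relation that closes the first order system of the pullback. -/
theorem klein_covariant (s : R) :
    20 * kleinFace s * s * kleinVertex s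
        * (kleinVertex s * kleinFaceDeriv s + s * (2 * s - 11) * kleinFaceDeriv s
          + s * kleinVertex s * (12 * s ^ 2 + 1368 * s + 988))
      - 31 * (s * kleinVertex s * kleinFaceDeriv s) ^ 2
      = -(4 * kleinEdge s * (s * kleinVertex s * kleinFaceDeriv s))
        + 3648 * s * kleinVertex s ^ 5 := by
  unfold kleinFace kleinVertex kleinEdge kleinFaceDeriv
  ring

variable [IsDomain R] [CharZero R] {k : Type*} [CommRing k] [Algebra k R]
  {D : Derivation k R R} {w s g : R}

/-- The derivative of the pullback variable, from the logarithmic derivative of its equation. -/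
theorem derivation_pullback_aux (hw : D w = w)
    (h₁ : 1728 * s * kleinVertex s ^ 5 * facePoly w ^ 3
      = -(20131375 * w ^ 4 * singQuad w ^ 3 * vertexPoly w ^ 5 * kleinFace s ^ 3))
    (he : kleinVertex s ≠ 0) (hP : facePoly w ≠ 0) :
    D s * singQuad w * vertexPoly w * facePoly w * kleinEdge s
      = s * kleinVertex s * kleinFace s * (7 * w - 31) * edgePoly w := by
  have hD := congrArg D h₁
  simp only [map_neg, D.leibniz, D.leibniz_pow, derivation_singQuad D hw,
    derivation_vertexPoly D hw, derivation_facePoly D hw, derivation_kleinVertex,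
    derivation_kleinFace, derivation_ofNat, hw, smul_eq_mul, nsmul_eq_mul] at hD
  push_cast at hD
  -- Equality of the logarithmic derivatives of the two sides of `h₁`, cleared of denominators.
  have hA : singQuad w * vertexPoly w * kleinFace s
        * (kleinVertex s * facePoly w * D s + 5 * s * (2 * s - 11) * D s * facePoly w
          + 3 * s * kleinVertex s * facePolyEuler w)
      = s * kleinVertex s * facePoly w
        * (4 * singQuad w * vertexPoly w * kleinFace s
          + 3 * singQuadEuler w * vertexPoly w * kleinFace s
          + 5 * singQuad w * vertexPolyEuler w * kleinFace s
          + 3 * singQuad w * vertexPoly w * kleinFaceDeriv s * D s) := by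
    have h0 : 1728 * kleinVertex s ^ 4 * facePoly w ^ 2 ≠ 0 :=
      mul_ne_zero (mul_ne_zero (by norm_num) (pow_ne_zero _ he)) (pow_ne_zero _ hP)
    apply mul_left_cancel₀ h0
    linear_combination singQuad w * vertexPoly w * kleinFace s * hD
      - (4 * singQuad w * vertexPoly w * kleinFace s
          + 3 * singQuadEuler w * vertexPoly w * kleinFace s
          + 5 * singQuad w * vertexPolyEuler w * kleinFace s
          + 3 * singQuad w * vertexPoly w * kleinFaceDeriv s * D s) * h₁
  linear_combination -hA + D s * singQuad w * vertexPoly w * facePoly w * klein_ramification s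
    - s * kleinVertex s * kleinFace s * pullback_ramification w

/-- By `h₂` and `h₃`, `P / H` and `Q / T` are constant multiples of `g²⁰ q¹²` and `g³⁰ q¹⁸`. Their
quotient turns the factor `H Q / (T P)` in the derivative of `s` into a multiple of `g¹⁰ q⁶`. -/
theorem derivation_pullback (hw : D w = w)
    (h₁ : 1728 * s * kleinVertex s ^ 5 * facePoly w ^ 3
      = -(20131375 * w ^ 4 * singQuad w ^ 3 * vertexPoly w ^ 5 * kleinFace s ^ 3))
    (h₂ : 20736 ^ 2 * g ^ 20 * singQuad w ^ 12 * kleinFace s = 5 ^ 6 * facePoly w)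
    (h₃ : 20736 ^ 3 * g ^ 30 * singQuad w ^ 18 * kleinEdge s = 5 ^ 9 * edgePoly w)
    (he : kleinVertex s ≠ 0) (hP : facePoly w ≠ 0) (hq : singQuad w ≠ 0)
    (hT : kleinEdge s ≠ 0) :
    125 * vertexPoly w * D s
      = 20736 * (7 * w - 31) * singQuad w ^ 5 * g ^ 10 * s * kleinVertex s := by
  have hB := derivation_pullback_aux hw h₁ he hP
  have h0 : 5 ^ 6 * singQuad w * facePoly w * kleinEdge s ≠ 0 :=
    mul_ne_zero (mul_ne_zero (mul_ne_zero (by norm_num) hq) hP) hT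
  apply mul_left_cancel₀ h0
  linear_combination 125 * 5 ^ 6 * hB
    - s * kleinVertex s * kleinFace s * (7 * w - 31) * h₃
    + s * kleinVertex s * (7 * w - 31) * 20736 * g ^ 10 * singQuad w ^ 6 * kleinEdge s * h₂

/-- Logarithmic differentiation of `h₂` produces the term `H'(s) D s / H(s)`. Replacing `D s` by
`h₄` and `1 / H` by `h₂` makes it a multiple of `G / g`, which is why `G` is chosen as it is. -/
theorem system_left {G : R} (hw : D w = w)
    (h₂ : 20736 ^ 2 * g ^ 20 * singQuad w ^ 12 * kleinFace s = 5 ^ 6 * facePoly w)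
    (h₄ : 125 * vertexPoly w * D s
      = 20736 * (7 * w - 31) * singQuad w ^ 5 * g ^ 10 * s * kleinVertex s)
    (hG : 5 ^ 9 * G
      = 20736 ^ 3 * singQuad w ^ 18 * g ^ 31 * (s * kleinVertex s * kleinFaceDeriv s))
    (hq : singQuad w ≠ 0) (hg : g ≠ 0) (hH : kleinFace s ≠ 0) :
    sysDenom w * D g = vertexPoly w * logDerivNum w * g + (31 - 7 * w) * G := by
  have hD := congrArg D h₂
  simp only [D.leibniz, D.leibniz_pow, derivation_singQuad D hw, derivation_facePoly D hw,
    derivation_kleinFace, derivation_ofNat, smul_eq_mul, nsmul_eq_mul] at hD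
  push_cast at hD
  have hF : 20 * D g * singQuad w * facePoly w * kleinFace s
        + 12 * facePoly w * g * singQuadEuler w * kleinFace s
        + g * singQuad w * facePoly w * kleinFaceDeriv s * D s
      = facePolyEuler w * singQuad w * kleinFace s * g := by
    have h0 : 20736 ^ 2 * g ^ 19 * singQuad w ^ 11 ≠ 0 :=
      mul_ne_zero (mul_ne_zero (by norm_num) (pow_ne_zero _ hg)) (pow_ne_zero _ hq)
    apply mul_left_cancel₀ h0
    linear_combination facePoly w * hD - facePolyEuler w * h₂
  have h0 : 5 ^ 9 * kleinFace s ≠ 0 := mul_ne_zero (by norm_num) hH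
  apply mul_left_cancel₀ h0
  unfold sysDenom logDerivNum
  linear_combination 5 ^ 9 * vertexPoly w * hF
    - 5 ^ 6 * g * singQuad w * facePoly w * kleinFaceDeriv s * h₄
    + 20736 * (7 * w - 31) * singQuad w ^ 6 * g ^ 11 * s * kleinVertex s * kleinFaceDeriv s * h₂
    + kleinFace s * (7 * w - 31) * hG

/-- By `klein_covariant` the part of `D G` quadratic in `H'(s)` reduces to two terms: `T s e H'`,
proportional to `G` through `h₃`, and `s e⁵`, a function of `w` times a power of `g` through `hJ`.
The factors 9 and 19 come from `3648 / 1728 = 19 / 9`. -/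
theorem system_right {G : R} (hw : D w = w)
    (h₁ : 1728 * s * kleinVertex s ^ 5 * facePoly w ^ 3
      = -(20131375 * w ^ 4 * singQuad w ^ 3 * vertexPoly w ^ 5 * kleinFace s ^ 3))
    (h₂ : 20736 ^ 2 * g ^ 20 * singQuad w ^ 12 * kleinFace s = 5 ^ 6 * facePoly w)
    (h₃ : 20736 ^ 3 * g ^ 30 * singQuad w ^ 18 * kleinEdge s = 5 ^ 9 * edgePoly w)
    (h₄ : 125 * vertexPoly w * D s
      = 20736 * (7 * w - 31) * singQuad w ^ 5 * g ^ 10 * s * kleinVertex s)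
    (hG : 5 ^ 9 * G
      = 20736 ^ 3 * singQuad w ^ 18 * g ^ 31 * (s * kleinVertex s * kleinFaceDeriv s))
    (hH : kleinFace s ≠ 0)
    (h₅ : sysDenom w * D g = vertexPoly w * logDerivNum w * g + (31 - 7 * w) * G) :
    9 * (sysDenom w * D G) = 9 * (sysDiag w * G) + sysOffDiag w * g := by
  have hN : D (kleinFaceDeriv s) = (12 * s ^ 2 + 1368 * s + 988) * D s := by
    simp only [kleinFaceDeriv, map_add, map_sub, D.leibniz, D.leibniz_pow, derivation_ofNat,
      smul_eq_mul, nsmul_eq_mul]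
    push_cast
    ring
  have hD := congrArg D hG
  simp only [D.leibniz, D.leibniz_pow, derivation_singQuad D hw, derivation_kleinVertex, hN,
    derivation_ofNat, smul_eq_mul, nsmul_eq_mul, smul_zero, mul_zero, add_zero] at hD
  push_cast at hD
  have hJ : 1728 * 20736 ^ 6 * singQuad w ^ 36 * g ^ 60 * s * kleinVertex s ^ 5
      = -(20131375 * 5 ^ 18 * w ^ 4 * singQuad w ^ 3 * vertexPoly w ^ 5) := by
    have hc : 20736 ^ 6 * g ^ 60 * singQuad w ^ 36 * kleinFace s ^ 3
        = 5 ^ 18 * facePoly w ^ 3 := by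
      linear_combination congrArg (· ^ 3) h₂
    apply mul_left_cancel₀ (pow_ne_zero 3 hH)
    linear_combination 1728 * s * kleinVertex s ^ 5 * hc + 5 ^ 18 * h₁
  -- The product rule for `q¹⁸ g³¹ s e H'(s)`: 31 is the exponent of `g`, and `360 = 20 * 18`
  -- combines the 20 of `sysDenom` with the exponent of `q`.
  have hK : 5 ^ 18 * (sysDenom w * D G)
      = 5 ^ 18 * (31 * vertexPoly w * logDerivNum w
          + 360 * singQuadEuler w * facePoly w * vertexPoly w) * G
        + (7 * w - 31) * 20736 ^ 6 * singQuad w ^ 36 * g ^ 61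
          * (20 * kleinFace s * s * kleinVertex s
            * (kleinVertex s * kleinFaceDeriv s + s * (2 * s - 11) * kleinFaceDeriv s
              + s * kleinVertex s * (12 * s ^ 2 + 1368 * s + 988))
            - 31 * (s * kleinVertex s * kleinFaceDeriv s) ^ 2) := by
    have hY := h₅
    unfold sysDenom at hY ⊢
    linear_combination 5 ^ 9 * (20 * singQuad w * facePoly w * vertexPoly w) * hD
      + 5 ^ 9 * 20736 ^ 3 * 31 * singQuad w ^ 18 * g ^ 30
        * (s * kleinVertex s * kleinFaceDeriv s) * hY
      - 5 ^ 9 * (31 * vertexPoly w * logDerivNum w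
          + 360 * singQuadEuler w * facePoly w * vertexPoly w) * hG
      + 20736 ^ 3 * 31 * singQuad w ^ 18 * g ^ 30 * (s * kleinVertex s * kleinFaceDeriv s)
        * (31 - 7 * w) * hG
      + 5 ^ 6 * 20736 ^ 3 * singQuad w ^ 19 * g ^ 31 * 20 * facePoly w
        * (kleinVertex s * kleinFaceDeriv s + s * (2 * s - 11) * kleinFaceDeriv s
        + s * kleinVertex s * (12 * s ^ 2 + 1368 * s + 988)) * h₄
      - 20736 ^ 4 * singQuad w ^ 24 * g ^ 41 * 20 * (7 * w - 31) * s * kleinVertex s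
        * (kleinVertex s * kleinFaceDeriv s + s * (2 * s - 11) * kleinFaceDeriv s
        + s * kleinVertex s * (12 * s ^ 2 + 1368 * s + 988)) * h₂
  rw [klein_covariant] at hK
  have h0 : (5 : R) ^ 18 ≠ 0 := by norm_num
  apply mul_left_cancel₀ h0
  unfold sysDiag sysOffDiag
  linear_combination 9 * hK + 19 * (7 * w - 31) * g * hJ
    - 36 * (7 * w - 31) * 20736 ^ 3 * singQuad w ^ 18 * g ^ 31
      * (s * kleinVertex s * kleinFaceDeriv s) * h₃
    + 36 * (7 * w - 31) * 5 ^ 9 * edgePoly w * hG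

end Pullback

/-! ### Power series: Hensel's lemma and the Euler derivation -/

open PowerSeries in
/-- Hensel's lemma for monic polynomials over a power series ring. -/
theorem exists_isRoot_powerSeries {K : Type*} [Field K] {f : Polynomial K⟦X⟧} (hf : f.Monic)
    (a : K⟦X⟧) (h₀ : constantCoeff (f.eval a) = 0)
    (h₁ : constantCoeff (f.derivative.eval a) ≠ 0) :
    ∃ b : K⟦X⟧, f.IsRoot b ∧ constantCoeff b = constantCoeff a := by
  have hu : IsUnit (f.derivative.eval a) := isUnit_iff_constantCoeff.mpr h₁.isUnit
  obtain ⟨b, hb, hba⟩ := HenselianRing.is_henselian (I := Ideal.span {(X : K⟦X⟧)}) f hf a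
    (Ideal.mem_span_singleton.mpr (X_dvd_iff.mpr h₀)) (hu.map _)
  refine ⟨b, hb, ?_⟩
  have := X_dvd_iff.mp (Ideal.mem_span_singleton.mp hba)
  rwa [map_sub, sub_eq_zero] at this

section Maps

variable {R S : Type*} [CommRing R] [CommRing S] (f : R →+* S) (w : R)

theorem map_kleinVertex : f (kleinVertex w) = kleinVertex (f w) := by
  simp [kleinVertex, map_ofNat]

theorem map_kleinFace : f (kleinFace w) = kleinFace (f w) := by
  simp [kleinFace, map_ofNat]

theorem map_kleinEdge : f (kleinEdge w) = kleinEdge (f w) := by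
  simp [kleinEdge, map_ofNat]

theorem map_singQuad : f (singQuad w) = singQuad (f w) := by
  simp [singQuad, map_ofNat]

theorem map_vertexPoly : f (vertexPoly w) = vertexPoly (f w) := by
  simp [vertexPoly, map_ofNat]

theorem map_facePoly : f (facePoly w) = facePoly (f w) := by
  simp [facePoly, map_ofNat]

theorem map_edgePoly : f (edgePoly w) = edgePoly (f w) := by
  simp [edgePoly, map_ofNat]

end Maps

open PowerSeries

instance : CharZero ℚ⟦X⟧ := charZero_of_injective_algebraMap (algebraMap ℚ ℚ⟦X⟧).injective

/-- The Euler derivation `X * d/dX` on power series. -/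
noncomputable def euler : Derivation ℚ ℚ⟦X⟧ ℚ⟦X⟧ := (X : ℚ⟦X⟧) • derivative ℚ

theorem coeff_euler (f : ℚ⟦X⟧) (n : ℕ) : coeff n (euler f) = n * coeff n f := by
  change coeff n ((X : ℚ⟦X⟧) * derivative ℚ f) = _
  cases n with
  | zero => simp
  | succ n => rw [coeff_succ_X_mul, coeff_derivative, mul_comm]; push_cast; rfl

/-- The normalized variable `43200 * X`. -/
noncomputable def param : ℚ⟦X⟧ := C 43200 * X

theorem constantCoeff_param : constantCoeff param = 0 := by simp [param]

theorem euler_param : euler param = param := by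
  ext n
  rw [coeff_euler, param, coeff_C_mul, coeff_X]
  split_ifs with h <;> simp [h]

/-- The polynomial defining the pullback variable, in homogeneous form. -/
noncomputable def pullbackForm (a b : ℚ⟦X⟧) : Polynomial ℚ⟦X⟧ :=
  Polynomial.C a * (Polynomial.X * (1 + Polynomial.X)
      * (Polynomial.X ^ 2 - 11 * Polynomial.X * (1 + Polynomial.X) - (1 + Polynomial.X) ^ 2) ^ 5)
    + Polynomial.C b * (Polynomial.X ^ 4 + 228 * Polynomial.X ^ 3 * (1 + Polynomial.X)
      + 494 * Polynomial.X ^ 2 * (1 + Polynomial.X) ^ 2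
      - 228 * Polynomial.X * (1 + Polynomial.X) ^ 3 + (1 + Polynomial.X) ^ 4) ^ 3

/-- As a polynomial in `s` the equation has leading coefficient `b`, not a unit, so it cannot be
made monic. The substitution `s = σ / (1 + σ)` sends `σ = ∞` to `s = 1`, and the new leading
coefficient `a e(1)⁵ + b H(1)³` is a unit. Modulo `X`, `σ = 0` is a simple root. -/
theorem exists_kleinParameter {a b : ℚ⟦X⟧} (ha : constantCoeff a ≠ 0)
    (hb : constantCoeff b = 0) :
    ∃ s : ℚ⟦X⟧, constantCoeff s = 0 ∧ a * (s * kleinVertex s ^ 5) + b * kleinFace s ^ 3 = 0 := by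
  have hdeg : (pullbackForm a b).natDegree ≤ 12 := by
    unfold pullbackForm
    compute_degree
  have hcoeff : (pullbackForm a b).coeff 12 = a * (-11) ^ 5 + b * 496 ^ 3 := by
    unfold pullbackForm
    compute_degree
    all_goals norm_num
  have hl : constantCoeff (a * (-11) ^ 5 + b * 496 ^ 3) ≠ 0 := by
    simpa [hb, map_ofNat] using ha
  set l : ℚ⟦X⟧ := a * (-11) ^ 5 + b * 496 ^ 3 with hldef
  have hmonic : (Polynomial.C l⁻¹ * pullbackForm a b).Monic := by
    refine Polynomial.monic_of_natDegree_le_of_coeff_eq_one 12 ?_ ?_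
    · exact (Polynomial.natDegree_C_mul_le _ _).trans hdeg
    · rw [Polynomial.coeff_C_mul, hcoeff, PowerSeries.inv_mul_cancel _ hl]
  obtain ⟨σ, hσ, hσ0⟩ := exists_isRoot_powerSeries hmonic 0
    (by simp [pullbackForm, hb])
    (by
      have : constantCoeff l ≠ 0 := hl
      simp [pullbackForm, hb, Polynomial.derivative_pow, ha, this])
  have hl' : l⁻¹ ≠ 0 := fun h => by
    have := PowerSeries.inv_mul_cancel _ hl
    simp [h] at this
  have hroot : (pullbackForm a b).eval σ = 0 := by
    have h := hσ.eq_zero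
    rw [Polynomial.eval_mul, Polynomial.eval_C] at h
    exact (mul_eq_zero.mp h).resolve_left hl'
  rw [map_zero] at hσ0
  have hτ : constantCoeff (1 + σ) ≠ 0 := by simp [hσ0]
  have hτinv := PowerSeries.mul_inv_cancel _ hτ
  refine ⟨σ * (1 + σ)⁻¹, by simp [hσ0], ?_⟩
  simp only [pullbackForm, Polynomial.eval_add, Polynomial.eval_mul, Polynomial.eval_C,
    Polynomial.eval_X, Polynomial.eval_one, Polynomial.eval_pow, Polynomial.eval_sub,
    Polynomial.eval_ofNat] at hroot
  have hσ' : σ = σ * (1 + σ)⁻¹ * (1 + σ) := by rw [mul_assoc, mul_comm _ (1 + σ), hτinv, mul_one]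
  have hτ0 : (1 + σ) ≠ 0 := fun h => hτ (by rw [h, map_zero])
  generalize σ * (1 + σ)⁻¹ = s at hσ'
  apply mul_left_cancel₀ (pow_ne_zero 12 hτ0)
  generalize 1 + σ = t at *
  subst hσ'
  unfold kleinVertex kleinFace
  linear_combination hroot

theorem exists_root_pow {u : ℚ⟦X⟧} (hu : constantCoeff u = 1) {n : ℕ} (hn : n ≠ 0) :
    ∃ g : ℚ⟦X⟧, constantCoeff g = 1 ∧ g ^ n = u := by
  obtain ⟨g, hg, hg1⟩ := exists_isRoot_powerSeries (Polynomial.monic_X_pow_sub_C u hn) 1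
    (by simp [hu]) (by simp [Polynomial.derivative_X_pow, hn])
  refine ⟨g, by simpa using hg1, ?_⟩
  simpa [sub_eq_zero] using hg.eq_zero

theorem ne_zero_of_constantCoeff {f : ℚ⟦X⟧} (h : constantCoeff f ≠ 0) : f ≠ 0 :=
  fun h0 => h (by rw [h0, map_zero])

/-! ### The algebraic solution -/

theorem isAlgebraic_param : IsAlgebraic (Polynomial ℚ) param := by
  have : param = algebraMap (Polynomial ℚ) ℚ⟦X⟧ (Polynomial.C 43200 * Polynomial.X) := by
    rw [PowerSeries.algebraMap_apply']
    simp [param]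
  rw [this]
  exact isAlgebraic_algebraMap _

theorem isAlgebraic_of_kleinParameter {s : ℚ⟦X⟧}
    (h : 1728 * s * kleinVertex s ^ 5 * facePoly param ^ 3
      = -(20131375 * param ^ 4 * singQuad param ^ 3 * vertexPoly param ^ 5 * kleinFace s ^ 3)) :
    IsAlgebraic (Polynomial ℚ) s := by
  set v : Polynomial ℚ := Polynomial.C 43200 * Polynomial.X with hv
  have hvp : algebraMap (Polynomial ℚ) ℚ⟦X⟧ v = param := by
    rw [PowerSeries.algebraMap_apply']
    simp [param, hv]
  refine ⟨1728 * Polynomial.X * kleinVertex Polynomial.X ^ 5 * facePoly (Polynomial.C v) ^ 3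
    + 20131375 * Polynomial.C v ^ 4 * singQuad (Polynomial.C v) ^ 3
      * vertexPoly (Polynomial.C v) ^ 5 * kleinFace Polynomial.X ^ 3, fun h0 => ?_, ?_⟩
  -- At `s = 0`, `w = 1` only `20131375 q(1)³ V(1)⁵` remains, and it is nonzero.
  · have h1 := congrArg (fun p => ((Polynomial.evalRingHom (1 / 43200 : ℚ)).comp
      (Polynomial.evalRingHom (0 : Polynomial ℚ))) p) h0
    simp only [map_add, map_mul, map_pow, map_kleinVertex, map_facePoly, map_singQuad,
      map_vertexPoly, map_kleinFace] at h1
    simp [hv, singQuad, vertexPoly, kleinFace] at h1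
    try norm_num at h1
  · rw [← AlgHom.coe_toRingHom]
    simp only [map_add, map_mul, map_pow, map_kleinVertex, map_facePoly, map_singQuad,
      map_vertexPoly, map_kleinFace, map_ofNat]
    simp only [AlgHom.coe_toRingHom, Polynomial.aeval_X, Polynomial.aeval_C, hvp]
    linear_combination h

/-- There is an algebraic power series with constant term `1` satisfying the second order
differential equation. -/
theorem exists_algebraic_solution :
    ∃ g : ℚ⟦X⟧, constantCoeff g = 1 ∧ IsAlgebraic (Polynomial ℚ) g ∧
      odeCoeff₂ param * euler (euler g) + odeCoeff₁ param * euler g + odeCoeff₀ param * g = 0 := by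
  have cq : constantCoeff (singQuad param) = 5 := by
    rw [map_singQuad, constantCoeff_param]; simp [singQuad]
  have cV : constantCoeff (vertexPoly param) = 4017600 := by
    rw [map_vertexPoly, constantCoeff_param]; simp [vertexPoly]
  have cP : constantCoeff (facePoly param) = 6718464000000 := by
    rw [map_facePoly, constantCoeff_param]; simp [facePoly]
  have cQ : constantCoeff (edgePoly param) = 17414258688000000000 := by
    rw [map_edgePoly, constantCoeff_param]; simp [edgePoly]
  obtain ⟨s, hs0, hs⟩ := exists_kleinParameter (a := 1728 * facePoly param ^ 3)
    (b := 20131375 * param ^ 4 * singQuad param ^ 3 * vertexPoly param ^ 5)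
    (by simp [cP, map_ofNat]) (by simp [constantCoeff_param])
  have h₁ : 1728 * s * kleinVertex s ^ 5 * facePoly param ^ 3
      = -(20131375 * param ^ 4 * singQuad param ^ 3 * vertexPoly param ^ 5 * kleinFace s ^ 3) := by
    linear_combination hs
  have ce : constantCoeff (kleinVertex s) = -1 := by
    rw [map_kleinVertex, hs0]; simp [kleinVertex]
  have cH : constantCoeff (kleinFace s) = 1 := by
    rw [map_kleinFace, hs0]; simp [kleinFace]
  have cT : constantCoeff (kleinEdge s) = 1 := by
    rw [map_kleinEdge, hs0]; simp [kleinEdge]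
  have hq := ne_zero_of_constantCoeff (f := singQuad param) (by rw [cq]; norm_num)
  have hV := ne_zero_of_constantCoeff (f := vertexPoly param) (by rw [cV]; norm_num)
  have hP := ne_zero_of_constantCoeff (f := facePoly param) (by rw [cP]; norm_num)
  have he := ne_zero_of_constantCoeff (f := kleinVertex s) (by rw [ce]; norm_num)
  have hH := ne_zero_of_constantCoeff (f := kleinFace s) (by rw [cH]; norm_num)
  have hT := ne_zero_of_constantCoeff (f := kleinEdge s) (by rw [cT]; norm_num)
  have cy : constantCoeff (20736 ^ 2 * singQuad param ^ 12 * kleinFace s) = 20736 ^ 2 * 5 ^ 12 := by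
    simp only [map_mul, map_pow, cq, cH, map_ofNat, mul_one]
  -- The constants `20736²` and `5⁶` give the radicand constant term `1`.
  obtain ⟨g, hg1, hg⟩ := exists_root_pow (n := 20)
    (u := (20736 ^ 2 * singQuad param ^ 12 * kleinFace s)⁻¹ * (5 ^ 6 * facePoly param))
    (by
      rw [map_mul, PowerSeries.constantCoeff_inv, cy]
      simp only [map_mul, map_pow, cP, map_ofNat]
      norm_num) (by norm_num)
  have hyg : (20736 ^ 2 * singQuad param ^ 12 * kleinFace s) * g ^ 20 = 5 ^ 6 * facePoly param := by
    rw [hg, ← mul_assoc, PowerSeries.mul_inv_cancel _ (by rw [cy]; norm_num), one_mul]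
  have h₂ : 20736 ^ 2 * g ^ 20 * singQuad param ^ 12 * kleinFace s = 5 ^ 6 * facePoly param := by
    linear_combination hyg
  have hg0 := ne_zero_of_constantCoeff (f := g) (by rw [hg1]; norm_num)
  have h₃ : 20736 ^ 3 * g ^ 30 * singQuad param ^ 18 * kleinEdge s = 5 ^ 9 * edgePoly param := by
    -- The squares agree because `T² / H³ = 1 - J = 1 - φ = Q² / P³`; constant terms then fix the
    -- sign.
    have hsq : (20736 ^ 3 * g ^ 30 * singQuad param ^ 18 * kleinEdge s) ^ 2
        = (5 ^ 9 * edgePoly param) ^ 2 := by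
      apply mul_left_cancel₀ (pow_ne_zero 3 hH)
      linear_combination kleinEdge s ^ 2 * congrArg (· ^ 3) h₂
        + 5 ^ 18 * facePoly param ^ 3 * kleinEdge_sq s - 5 ^ 18 * h₁
        + 5 ^ 18 * kleinFace s ^ 3 * facePoly_cube param
    refine (sq_eq_sq_iff_eq_or_eq_neg.mp hsq).resolve_right fun h => ?_
    have h' := congrArg constantCoeff h
    simp only [map_mul, map_pow, map_neg, cq, cT, cQ, hg1, map_ofNat] at h'
    norm_num at h'
  have h₄ := derivation_pullback (D := euler) euler_param h₁ h₂ h₃ he hP hq hT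
  obtain ⟨G, hG⟩ : ∃ G : ℚ⟦X⟧, 5 ^ 9 * G
      = 20736 ^ 3 * singQuad param ^ 18 * g ^ 31 * (s * kleinVertex s * kleinFaceDeriv s) := by
    refine ⟨C (1 / 5 ^ 9) * (20736 ^ 3 * singQuad param ^ 18 * g ^ 31
      * (s * kleinVertex s * kleinFaceDeriv s)), ?_⟩
    rw [← mul_assoc, show (5 : ℚ⟦X⟧) ^ 9 = C (5 ^ 9) by simp [map_ofNat], ← map_mul]
    norm_num
  have h₅ := system_left (D := euler) euler_param h₂ h₄ hG hq hg0 hH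
  have h₆ := system_right (D := euler) euler_param h₁ h₂ h₃ h₄ hG hH h₅
  have hM : sysDenom param ≠ 0 :=
    mul_ne_zero (mul_ne_zero (mul_ne_zero (by norm_num) hq) hP) hV
  refine ⟨g, hg1, ?_, ode_of_system euler euler_param hM h₅ h₆⟩
  have aw := isAlgebraic_param
  have as := isAlgebraic_of_kleinParameter h₁
  -- Polynomial expressions in `param` and `s` are formed inside the subalgebra of algebraic
  -- elements, so they are algebraic without further argument.
  set A := Subalgebra.algebraicClosure (Polynomial ℚ) ℚ⟦X⟧
  let w' : A := ⟨param, aw⟩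
  let s' : A := ⟨s, as⟩
  have hy : IsAlgebraic (Polynomial ℚ) (20736 ^ 2 * singQuad param ^ 12 * kleinFace s) := by
    have h : A.val.toRingHom (20736 ^ 2 * singQuad w' ^ 12 * kleinFace s')
        = 20736 ^ 2 * singQuad param ^ 12 * kleinFace s := by
      simp only [map_mul, map_pow, map_singQuad, map_kleinFace, map_ofNat]
      rfl
    exact h ▸ (20736 ^ 2 * singQuad w' ^ 12 * kleinFace s').2
  have hz : IsAlgebraic (Polynomial ℚ) (5 ^ 6 * facePoly param) := by
    have h : A.val.toRingHom (5 ^ 6 * facePoly w') = 5 ^ 6 * facePoly param := by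
      simp only [map_mul, map_pow, map_facePoly, map_ofNat]
      rfl
    exact h ▸ (5 ^ 6 * facePoly w').2
  refine IsAlgebraic.of_pow (n := 20) (by norm_num)
    (IsAlgebraic.of_mul (mem_nonZeroDivisors_of_ne_zero ?_) hy (hyg ▸ hz))
  exact ne_zero_of_constantCoeff (by rw [cy]; norm_num)

/-! ### From the differential equation to a recurrence -/

/-- The coefficients of a power series in the variable `param`, extended by zero to `ℤ`. -/
noncomputable def paramCoeff (f : ℚ⟦X⟧) (n : ℤ) : ℚ :=
  if 0 ≤ n then coeff n.toNat f / 43200 ^ n.toNat else 0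

theorem paramCoeff_natCast (f : ℚ⟦X⟧) (n : ℕ) : paramCoeff f n = coeff n f / 43200 ^ n := by
  simp [paramCoeff]

theorem paramCoeff_of_neg (f : ℚ⟦X⟧) {n : ℤ} (hn : n < 0) : paramCoeff f n = 0 :=
  if_neg (not_le.mpr hn)

theorem paramCoeff_add (f h : ℚ⟦X⟧) (n : ℤ) :
    paramCoeff (f + h) n = paramCoeff f n + paramCoeff h n := by
  unfold paramCoeff
  split_ifs
  · rw [map_add, add_div]
  · rw [add_zero]

theorem paramCoeff_C_mul (a : ℚ) (f : ℚ⟦X⟧) (n : ℤ) :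
    paramCoeff (C a * f) n = a * paramCoeff f n := by
  unfold paramCoeff
  split_ifs
  · rw [coeff_C_mul, mul_div_assoc]
  · rw [mul_zero]

theorem paramCoeff_euler (f : ℚ⟦X⟧) (n : ℤ) : paramCoeff (euler f) n = n * paramCoeff f n := by
  rcases lt_or_ge n 0 with hn | hn
  · rw [paramCoeff_of_neg _ hn, paramCoeff_of_neg _ hn, mul_zero]
  · lift n to ℕ using hn
    rw [paramCoeff_natCast, paramCoeff_natCast, coeff_euler, Int.cast_natCast, mul_div_assoc]

theorem paramCoeff_param_mul (f : ℚ⟦X⟧) (n : ℤ) :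
    paramCoeff (param * f) n = paramCoeff f (n - 1) := by
  rcases lt_or_ge n 0 with hn | hn
  · rw [paramCoeff_of_neg _ hn, paramCoeff_of_neg _ (by omega)]
  · lift n to ℕ using hn
    rw [paramCoeff_natCast, param, mul_assoc, coeff_C_mul]
    cases n with
    | zero => rw [coeff_zero_X_mul, paramCoeff_of_neg _ (by norm_num)]; simp
    | succ n =>
      rw [coeff_succ_X_mul, Nat.cast_succ, add_sub_cancel_right, paramCoeff_natCast, pow_succ]
      field_simp

theorem paramCoeff_param_pow_mul (f : ℚ⟦X⟧) (j : ℕ) (n : ℤ) :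
    paramCoeff (param ^ j * f) n = paramCoeff f (n - j) := by
  induction j generalizing n with
  | zero => simp
  | succ j ih =>
    rw [pow_succ', mul_assoc, paramCoeff_param_mul, ih]
    push_cast
    congr 1
    ring

/-- The recurrence for the coefficients that expresses the second order differential equation. -/
theorem paramCoeff_of_ode {g : ℚ⟦X⟧}
    (h : odeCoeff₂ param * euler (euler g) + odeCoeff₁ param * euler g + odeCoeff₀ param * g = 0)
    (n : ℤ) :
    (-558000 * (n : ℚ) ^ 2 + 446400 * n) * paramCoeff g n
      + (-2664000 * ((n : ℚ) - 1) ^ 2 - 2458800 * (n - 1) - 124775) * paramCoeff g (n - 1)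
      + (518400 * ((n : ℚ) - 2) ^ 2 - 393840 * (n - 2) - 139453) * paramCoeff g (n - 2)
      + (25200 * ((n : ℚ) - 3) ^ 2 + 35280 * (n - 3) + 12096) * paramCoeff g (n - 3) = 0 := by
  have e (a : ℚ) (j : ℕ) (f : ℚ⟦X⟧) :
      paramCoeff (C a * (param ^ j * f)) n = a * paramCoeff f (n - j) := by
    rw [paramCoeff_C_mul, paramCoeff_param_pow_mul]
  have h' : C (-558000) * (param ^ 0 * euler (euler g)) + C 446400 * (param ^ 0 * euler g)
      + C (-2664000) * (param ^ 1 * euler (euler g)) + C (-2458800) * (param ^ 1 * euler g)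
      + C (-124775) * (param ^ 1 * g)
      + C 518400 * (param ^ 2 * euler (euler g)) + C (-393840) * (param ^ 2 * euler g)
      + C (-139453) * (param ^ 2 * g)
      + C 25200 * (param ^ 3 * euler (euler g)) + C 35280 * (param ^ 3 * euler g)
      + C 12096 * (param ^ 3 * g) = 0 := by
    simp only [map_neg, map_ofNat]
    unfold odeCoeff₂ odeCoeff₁ odeCoeff₀ at h
    linear_combination h
  have h0 : paramCoeff 0 n = 0 := by simp [paramCoeff]
  have h'' := congrArg (fun f => paramCoeff f n) h'
  simp only [paramCoeff_add, e, paramCoeff_euler, h0] at h''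
  push_cast [sub_zero] at h''
  linear_combination h''

/-! ### Comparison with the Yang–Zagier recurrence -/

/-- The left-hand side of the Yang–Zagier recurrence at `n`, rescaled, for a sequence indexed by
the integers. -/
def recurrenceExpr (b : ℤ → ℚ) (n : ℤ) : ℚ :=
  (31 / 144 * (n : ℚ) ^ 2 - 31 / 180 * n) * b n
    + (5 * (n : ℚ) ^ 4 - 32 * n ^ 3 + 54331 / 720 * n ^ 2 - 272147 / 3600 * n + 14092603 / 518400)
      * b (n - 1)
    + (25 * (n : ℚ) ^ 4 - 170 * n ^ 3 + 76439 / 180 * n ^ 2 - 415367 / 900 * n + 138173 / 750)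
      * b (n - 2)
    + ((n : ℚ) ^ 4 - 36 / 5 * n ^ 3 + 473 / 25 * n ^ 2 - 2682 / 125 * n + 5544 / 625) * b (n - 3)

/-- The coefficient form of `(31 - 7w)² M = A L`, since `(31 - 7w)² = 961 - 434 w + 49 w²`; the
multipliers of `h0`, `h1`, `h2` are the coefficients of `A`. -/
theorem recurrenceExpr_relation {b : ℤ → ℚ}
    (h : ∀ n : ℤ, (-558000 * (n : ℚ) ^ 2 + 446400 * n) * b n
      + (-2664000 * ((n : ℚ) - 1) ^ 2 - 2458800 * (n - 1) - 124775) * b (n - 1)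
      + (518400 * ((n : ℚ) - 2) ^ 2 - 393840 * (n - 2) - 139453) * b (n - 2)
      + (25200 * ((n : ℚ) - 3) ^ 2 + 35280 * (n - 3) + 12096) * b (n - 3) = 0) (n : ℤ) :
    961 * recurrenceExpr b n - 434 * recurrenceExpr b (n - 1) + 49 * recurrenceExpr b (n - 2)
      = 0 := by
  have h0 := h n
  have h1 := h (n - 1)
  have h2 := h (n - 2)
  unfold recurrenceExpr
  rw [show n - 1 - 1 = n - 2 by ring, show n - 1 - 2 = n - 3 by ring,
    show n - 1 - 3 = n - 4 by ring] at h1 ⊢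
  rw [show n - 2 - 1 = n - 3 by ring, show n - 2 - 2 = n - 4 by ring,
    show n - 2 - 3 = n - 5 by ring] at h2 ⊢
  push_cast at h1 h2 ⊢
  linear_combination (-961 / 720 / 3600) * h0
    + (-31 * (n : ℚ) ^ 2 + 558 / 5 * n - 333343 / 3600) / 3600 * h1
    + (7 * (n : ℚ) ^ 2 - 231 / 5 * n + 1904 / 25) / 3600 * h2

/-- Since `961 ≠ 0`, zeros propagate upwards from the negative indices, two consecutive ones at a
time. -/
theorem recurrenceExpr_eq_zero {b : ℤ → ℚ} (hb : ∀ n < 0, b n = 0)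
    (h : ∀ n : ℤ, 961 * recurrenceExpr b n - 434 * recurrenceExpr b (n - 1)
      + 49 * recurrenceExpr b (n - 2) = 0) (n : ℕ) : recurrenceExpr b n = 0 := by
  have hneg : ∀ n < 0, recurrenceExpr b n = 0 := fun n hn => by
    unfold recurrenceExpr
    rw [hb n hn, hb (n - 1) (by omega), hb (n - 2) (by omega), hb (n - 3) (by omega)]
    ring
  have key : ∀ k : ℕ, recurrenceExpr b (k - 2) = 0 ∧ recurrenceExpr b (k - 1) = 0 := fun k => by
    induction k with
    | zero => exact ⟨hneg _ (by norm_num), hneg _ (by norm_num)⟩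
    | succ k ih =>
      have hk := h k
      rw [ih.1, ih.2] at hk
      push_cast
      rw [show (k : ℤ) + 1 - 2 = k - 1 by ring, show (k : ℤ) + 1 - 1 = k by ring]
      exact ⟨ih.2, by linarith⟩
  have := (key (n + 1)).2
  rwa [Nat.cast_succ, add_sub_cancel_right] at this

/-- The Yang–Zagier numbers, as coefficients in the variable `param`. -/
theorem yangZagierA_div (n : ℕ) :
    yangZagierA n / 43200 ^ n = yangZagierC n * (ascPochhammer ℚ n).eval (3 / 5)
      * (ascPochhammer ℚ n).eval (4 / 5) * 3600 ^ n := by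
  rw [yangZagierA, mul_div_assoc, ← div_pow]
  norm_num

/-- The leading coefficient `31/720 * n * (5 * n - 4)` vanishes at no integer `n ≥ 1`, so `b 0`
determines `b`. With zero values at negative indices, the recurrence at `n = 1, 2` yields exactly
the prescribed `c 1` and `c 2`. -/
theorem eq_yangZagierA {b : ℤ → ℚ} (hb : ∀ n < 0, b n = 0) (h0 : b 0 = 1)
    (h : ∀ n : ℕ, recurrenceExpr b n = 0) (n : ℕ) : b n = yangZagierA n / 43200 ^ n := by
  rw [yangZagierA_div]
  unfold recurrenceExpr at h
  have h1 : b 1 = -161 / (2 ^ 10 * 3 ^ 5) * (12 / 25) * 3600 := by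
    have := h 1
    norm_num [hb, h0] at this
    linarith
  induction n using Nat.strong_induction_on with
  | _ n ih =>
    match n with
    | 0 => simp [h0, yangZagierC]
    | 1 => simp [h1, yangZagierC]; norm_num
    | 2 =>
      have := h 2
      norm_num [hb, h0, h1] at this
      simp [yangZagierC, ascPochhammer_succ_eval]
      norm_num
      linarith
    | k + 3 =>
      have i0 := ih k (by omega)
      have i1 := ih (k + 1) (by omega)
      have i2 := ih (k + 2) (by omega)
      have hr := yangZagierC_recurrence (k + 3) (by omega)
      rw [show k + 3 - 1 = k + 2 from rfl, show k + 3 - 2 = k + 1 from rfl,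
        show k + 3 - 3 = k from rfl] at hr
      have hk := h (k + 3)
      push_cast at hk hr i1 i2 ⊢
      rw [show (k : ℤ) + 3 - 1 = k + 2 by ring, show (k : ℤ) + 3 - 2 = k + 1 by ring,
        show (k : ℤ) + 3 - 3 = k by ring, i0, i1, i2] at hk
      have hpos : (31 / 144 * ((k : ℚ) + 3) ^ 2 - 31 / 180 * (k + 3)) ≠ 0 := by
        have : 0 ≤ (k : ℚ) := k.cast_nonneg
        have : 31 / 144 * ((k : ℚ) + 3) ^ 2 - 31 / 180 * (k + 3)
          = 31 / 144 * (k + 3) * (k + 11 / 5) := by ring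
        rw [this]
        positivity
      apply mul_left_cancel₀ hpos
      simp only [ascPochhammer_succ_eval] at hk ⊢
      push_cast at hk ⊢
      -- With `n = k + 3`, the multiplier of `hr` is `(3/5)_{n-1} (4/5)_{n-1} 3600^{n-3}`; the last
      -- factors of `(3/5)_n (4/5)_n` absorb `(5n-2)(5n-1)`.
      linear_combination hk - ((ascPochhammer ℚ k).eval (3 / 5) * (3 / 5 + k) * (3 / 5 + (k + 1))
        * (ascPochhammer ℚ k).eval (4 / 5) * (4 / 5 + k) * (4 / 5 + (k + 1)) * 3600 ^ k) * hr

end YangZagier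

/-- The generating function of the Yang–Zagier numbers is algebraic: there is a nonzero
bivariate polynomial over `ℚ`, viewed as a polynomial in `y` over `ℚ[x]`, that vanishes at
`y = ∑ a n x^n` in `ℚ⟦x⟧`. -/
theorem mainTheorem1 :
    IsAlgebraic (Polynomial ℚ) (PowerSeries.mk yangZagierA : PowerSeries ℚ) := by
  obtain ⟨g, hg, halg, hode⟩ := YangZagier.exists_algebraic_solution
  have hneg : ∀ n < 0, YangZagier.paramCoeff g n = 0 :=
    fun n hn => YangZagier.paramCoeff_of_neg g hn
  have hzero : YangZagier.paramCoeff g 0 = 1 := by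
    simpa [hg] using YangZagier.paramCoeff_natCast g 0
  have hrec := YangZagier.recurrenceExpr_eq_zero hneg
    (YangZagier.recurrenceExpr_relation (YangZagier.paramCoeff_of_ode hode))
  have hmk : (PowerSeries.mk yangZagierA : PowerSeries ℚ) = g := by
    ext n
    have h := YangZagier.eq_yangZagierA hneg hzero hrec n
    rw [YangZagier.paramCoeff_natCast, div_left_inj' (pow_ne_zero n (by norm_num))] at h
    rw [PowerSeries.coeff_mk, h]
  rwa [hmk]
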